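/- Let $M$ be a smooth ($C^\infty$) $n$-dimensional manifold without boundary, let ${\bf x} : M \to \mathbb{E}^N$ be a smooth immersion into Euclidean $N$-space, and let $g$ be the Riemannian metric on $M$ induced by ${\bf x}$. Let $h$ be the second fundamental form of ${\bf x}$, that is, $h(X,Y)$ is the component normal to $M$ of the derivative $D_XY$ taken in $\mathbb{E}^N$, and let ${\bf H} = \frac1n\,\mathrm{trace}_g\, h : M \to \mathbb{E}^N$ be the mean curvature vector field (${\bf H} = 0$ if $n = 0$). Let $\Delta$ be the Laplace operator of $(M,g)$ (the trace of the Hessian), acting componentwise on $\mathbb{E}^N$-valued functions. Suppose that $M$ is biharmonic, i.e. $\Delta {\bf H} = 0$ on $M$, and that the immersion is proper, i.e. ${\bf x}^{-1}(K)$ is compact for every compact set $K \subset \mathbb{E}^N$. Then $M$ is minimal, i.e. ${\bf H} = 0$ on $M$. -/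

import Mathlib

open scoped Manifold ContDiff

noncomputable section

namespace Submanifold

/-! ### Local geometry of a parametrized submanifold

`X : ℝⁿ → E^N` is (near the point under consideration) a regular parametrization of a piece of an
immersed submanifold. All objects are given by their components in the coordinates `y₁, …, yₙ`. -/

/-- The partial derivative `∂ᵢ f` at `y`. -/
def pderiv {n : ℕ} {F : Type*} [NormedAddCommGroup F] [NormedSpace ℝ F] (i : Fin n)
    (f : EuclideanSpace ℝ (Fin n) → F) (y : EuclideanSpace ℝ (Fin n)) : F :=
  fderiv ℝ f y (EuclideanSpace.single i 1)

/-- The induced metric `g_{ij} = ⟨∂ᵢ X, ∂ⱼ X⟩`. -/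
def metric {n N : ℕ} (X : EuclideanSpace ℝ (Fin n) → EuclideanSpace ℝ (Fin N))
    (y : EuclideanSpace ℝ (Fin n)) : Matrix (Fin n) (Fin n) ℝ :=
  Matrix.of fun i j => inner ℝ (pderiv i X y) (pderiv j X y)

/-- The Christoffel symbols of the Levi-Civita connection of the induced metric,
`Γᵏ_{ij} = ½ ∑ₗ g^{kl} (∂ᵢ g_{jl} + ∂ⱼ g_{il} - ∂ₗ g_{ij})`. -/
def christoffel {n N : ℕ} (X : EuclideanSpace ℝ (Fin n) → EuclideanSpace ℝ (Fin N))
    (k i j : Fin n) (y : EuclideanSpace ℝ (Fin n)) : ℝ :=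
  (1 / 2) * ∑ l, (metric X y)⁻¹ k l *
    (pderiv i (fun z => metric X z j l) y + pderiv j (fun z => metric X z i l) y
      - pderiv l (fun z => metric X z i j) y)

/-- The (non-positive) Laplace operator of the induced metric, that is the trace of the Hessian,
`Δ f = ∑_{i,j} g^{ij} (∂ᵢ ∂ⱼ f - ∑ₖ Γᵏ_{ij} ∂ₖ f)`; for a vector-valued `f` it acts on each
component. -/
def localLaplacian {n N : ℕ} {F : Type*} [NormedAddCommGroup F] [NormedSpace ℝ F]
    (X : EuclideanSpace ℝ (Fin n) → EuclideanSpace ℝ (Fin N))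
    (f : EuclideanSpace ℝ (Fin n) → F) (y : EuclideanSpace ℝ (Fin n)) : F :=
  ∑ i, ∑ j, (metric X y)⁻¹ i j •
    (pderiv i (pderiv j f) y - ∑ k, christoffel X k i j y • pderiv k f y)

/-- The tangent space of the submanifold at `X y`, as a subspace of `E^N`. -/
def tangentPlane {n N : ℕ} (X : EuclideanSpace ℝ (Fin n) → EuclideanSpace ℝ (Fin N))
    (y : EuclideanSpace ℝ (Fin n)) : Submodule ℝ (EuclideanSpace ℝ (Fin N)) :=
  LinearMap.range (fderiv ℝ X y).toLinearMap

/-- The second fundamental form `h(∂ᵢ, ∂ⱼ)`: the normal component of `D_{∂ᵢ} ∂ⱼ = ∂ᵢ ∂ⱼ X`, where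
`D` is the flat connection of `E^N`. -/
def secondFundamentalForm {n N : ℕ} (X : EuclideanSpace ℝ (Fin n) → EuclideanSpace ℝ (Fin N))
    (i j : Fin n) (y : EuclideanSpace ℝ (Fin n)) : EuclideanSpace ℝ (Fin N) :=
  (tangentPlane X y)ᗮ.starProjection (pderiv i (pderiv j X) y)

/-- The mean curvature vector `H = (1/n) ∑_{i,j} g^{ij} h(∂ᵢ, ∂ⱼ)`, i.e. `1/n` times the trace of the
second fundamental form with respect to the induced metric. -/
def localMeanCurvature {n N : ℕ} (X : EuclideanSpace ℝ (Fin n) → EuclideanSpace ℝ (Fin N))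
    (y : EuclideanSpace ℝ (Fin n)) : EuclideanSpace ℝ (Fin N) :=
  (1 / (n : ℝ)) • ∑ i, ∑ j, (metric X y)⁻¹ i j • secondFundamentalForm X i j y

/-! ### Immersed submanifolds

The objects above do not depend on the parametrization; at a point `p` of the manifold they are
evaluated in the coordinates given by the chart at `p`. -/

/-- The `C^∞` map `x : M → E^N` is an immersion: its differential is injective at each point. -/
structure IsSmoothImmersion {n N : ℕ} {M : Type*} [TopologicalSpace M]
    [ChartedSpace (EuclideanSpace ℝ (Fin n)) M]
    (x : M → EuclideanSpace ℝ (Fin N)) : Prop where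
  smooth : ContMDiff (𝓡 n) 𝓘(ℝ, EuclideanSpace ℝ (Fin N)) ∞ x
  injective_mfderiv : ∀ p : M,
    Function.Injective (mfderiv (𝓡 n) 𝓘(ℝ, EuclideanSpace ℝ (Fin N)) x p)

/-- The mean curvature vector field `H : M → E^N` of the immersion `x`. -/
def meanCurvature {n N : ℕ} {M : Type*} [TopologicalSpace M]
    [ChartedSpace (EuclideanSpace ℝ (Fin n)) M]
    (x : M → EuclideanSpace ℝ (Fin N)) (p : M) : EuclideanSpace ℝ (Fin N) :=
  localMeanCurvature (x ∘ (chartAt (EuclideanSpace ℝ (Fin n)) p).symm)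
    (chartAt (EuclideanSpace ℝ (Fin n)) p p)

/-- The Laplace operator on `M`, for the metric induced by the immersion `x`, applied to a function
`f` on `M` with values in a normed space. -/
def laplacian {n N : ℕ} {M : Type*} [TopologicalSpace M]
    [ChartedSpace (EuclideanSpace ℝ (Fin n)) M]
    {F : Type*} [NormedAddCommGroup F] [NormedSpace ℝ F]
    (x : M → EuclideanSpace ℝ (Fin N)) (f : M → F) (p : M) : F :=
  localLaplacian (x ∘ (chartAt (EuclideanSpace ℝ (Fin n)) p).symm)
    (f ∘ (chartAt (EuclideanSpace ℝ (Fin n)) p).symm)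
    (chartAt (EuclideanSpace ℝ (Fin n)) p p)

/-- The immersed submanifold is biharmonic: `Δ H = 0`. -/
def IsBiharmonic {n N : ℕ} {M : Type*} [TopologicalSpace M]
    [ChartedSpace (EuclideanSpace ℝ (Fin n)) M]
    (x : M → EuclideanSpace ℝ (Fin N)) : Prop :=
  ∀ p : M, laplacian (n := n) x (meanCurvature (n := n) x) p = 0

/-- The immersed submanifold is minimal: `H = 0`. -/
def IsMinimal {n N : ℕ} {M : Type*} [TopologicalSpace M]
    [ChartedSpace (EuclideanSpace ℝ (Fin n)) M]
    (x : M → EuclideanSpace ℝ (Fin N)) : Prop :=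
  ∀ p : M, meanCurvature (n := n) x p = 0

end Submanifold

end

/-! The proof is an interior estimate by the maximum principle. Fix `R` and put u = R² - |x|².
Properness makes the preimage of the closed R-ball compact, so u²|H|² attains a maximum there; it
vanishes where |x| = R, so a positive maximum is interior.

At an interior maximum three facts meet. Since ΔH = 0, Δ|H|² = 2|DH|². The tangential part of DH is
minus the shape operator of H, whose trace is n|H|², so |DH|² ≥ n|H|⁴
(`IsFrame.mul_norm_meanCurvature_pow_le`). The Beltrami formula Δx = nH gives Δ|x|² = 2n + 2n⟨x, H⟩,
and |∇u|² ≤ 4R². The superlinear term |H|⁴ absorbs the others and yields u|H| ≤ 5R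
(`mul_norm_le_of_isLocalMax`).

Hence (R² - |x(q)|²)|H(q)| ≤ 5R for every R > |x(q)|. The left side grows quadratically in R and the
right side linearly, so H(q) = 0. -/

namespace Submanifold

/-! ### Traces, normal projection and the Beltrami formula at one point -/

section Frames

variable {n N : ℕ} {F : Type*} [NormedAddCommGroup F] [NormedSpace ℝ F]

theorem pderiv_pderiv {f : EuclideanSpace ℝ (Fin n) → F} {y : EuclideanSpace ℝ (Fin n)}
    (hf : ContDiffAt ℝ 2 f y) (i j : Fin n) :
    pderiv i (pderiv j f) y =
      fderiv ℝ (fderiv ℝ f) y (EuclideanSpace.single i 1) (EuclideanSpace.single j 1) := by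
  have h : DifferentiableAt ℝ (fderiv ℝ f) y :=
    (hf.fderiv_right (m := 1) (by norm_num)).differentiableAt (by norm_num)
  have h2 := (h.hasFDerivAt.clm_apply
    (hasFDerivAt_const (EuclideanSpace.single j (1 : ℝ)) y)).fderiv
  change fderiv ℝ (fun z => fderiv ℝ f z (EuclideanSpace.single j 1)) y _ = _
  rw [h2]
  simp

/-- The second derivative of a `C²` function is symmetric. -/
theorem fderiv_fderiv_symm {E : Type*} [NormedAddCommGroup E] [NormedSpace ℝ E] {f : E → F} {y : E}
    (hf : ContDiffAt ℝ 2 f y) (v w : E) :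
    fderiv ℝ (fderiv ℝ f) y v w = fderiv ℝ (fderiv ℝ f) y w v :=
  (hf.isSymmSndFDerivAt (by simp)) v w

/-- The vectors `E k` form a frame that the differential of `X` at `y` maps to an orthonormal
family. -/
def IsFrame (X : EuclideanSpace ℝ (Fin n) → EuclideanSpace ℝ (Fin N))
    (y : EuclideanSpace ℝ (Fin n)) (E : Fin n → EuclideanSpace ℝ (Fin n)) : Prop :=
  Orthonormal ℝ fun k => fderiv ℝ X y (E k)

variable {X : EuclideanSpace ℝ (Fin n) → EuclideanSpace ℝ (Fin N)}
  {y : EuclideanSpace ℝ (Fin n)} {E : Fin n → EuclideanSpace ℝ (Fin n)}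

/-- Pull back an orthonormal basis of the tangent plane. A frame at the single point suffices: the
second-order part of Δ is a pointwise trace, so no moving frame is differentiated. -/
theorem exists_isFrame (hX : Function.Injective (fderiv ℝ X y)) : ∃ E, IsFrame X y E := by
  have hr : Module.finrank ℝ (LinearMap.range (fderiv ℝ X y).toLinearMap) = n := by
    rw [LinearMap.finrank_range_of_inj hX]; simp
  let b := (stdOrthonormalBasis ℝ (LinearMap.range (fderiv ℝ X y).toLinearMap)).reindex
    (finCongr hr)
  have hb : ∀ k, ∃ e, fderiv ℝ X y e = b k := fun k => (b k).2
  choose E hE using hb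
  refine ⟨E, ?_⟩
  unfold IsFrame
  simp_rw [hE]
  exact b.orthonormal.comp_linearIsometry (Submodule.subtypeₗᵢ _)

theorem euclidean_eq_sum_single (v : EuclideanSpace ℝ (Fin n)) :
    v = ∑ i, v i • EuclideanSpace.single i (1 : ℝ) := by
  ext j
  simp [Finset.sum_apply, Pi.single_apply]

theorem IsFrame.mul_metric_mul (hE : IsFrame X y E) :
    (Matrix.of fun k i => E k i) * metric X y * (Matrix.of fun k i => E k i).transpose = 1 := by
  ext k l
  have h := (orthonormal_iff_ite.mp hE) k l
  rw [Matrix.one_apply, ← h]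
  conv_rhs => rw [euclidean_eq_sum_single (E k), euclidean_eq_sum_single (E l)]
  simp only [map_sum, map_smul, sum_inner, inner_sum, inner_smul_left, inner_smul_right,
    Matrix.mul_apply, Matrix.of_apply, Matrix.transpose_apply, metric, pderiv, Finset.sum_mul,
    Finset.mul_sum]
  refine Finset.sum_congr rfl fun i _ => Finset.sum_congr rfl fun j _ => ?_
  simp
  ring

theorem IsFrame.mul_metric (hE : IsFrame X y E) :
    ((Matrix.of fun k i => E k i).transpose * (Matrix.of fun k i => E k i)) * metric X y = 1 := by
  rw [Matrix.mul_assoc]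
  exact mul_eq_one_comm.mp hE.mul_metric_mul

theorem IsFrame.inv_metric (hE : IsFrame X y E) (i j : Fin n) :
    (metric X y)⁻¹ i j = ∑ k, E k i * E k j := by
  rw [Matrix.inv_eq_left_inv hE.mul_metric]
  simp [Matrix.mul_apply]

theorem isUnit_det_metric (hX : Function.Injective (fderiv ℝ X y)) :
    IsUnit (metric X y).det := by
  obtain ⟨E, hE⟩ := exists_isFrame hX
  exact (Matrix.isUnit_iff_isUnit_det _).mp (IsUnit.of_mul_eq_one_right _ hE.mul_metric)

/-- The trace of a bilinear map with respect to the induced metric, computed in a frame. -/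
theorem IsFrame.sum_inv_metric_smul (hE : IsFrame X y E)
    (T : EuclideanSpace ℝ (Fin n) →L[ℝ] EuclideanSpace ℝ (Fin n) →L[ℝ] F) :
    ∑ i, ∑ j, (metric X y)⁻¹ i j • T (EuclideanSpace.single i 1) (EuclideanSpace.single j 1) =
      ∑ k, T (E k) (E k) := by
  have h : ∀ k, T (E k) (E k) = ∑ i, ∑ j, (E k i * E k j) •
      T (EuclideanSpace.single i 1) (EuclideanSpace.single j 1) := by
    intro k
    conv_lhs => rw [euclidean_eq_sum_single (E k)]
    simp only [map_sum, map_smul, sum_apply, smul_apply,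
      Finset.smul_sum, smul_smul]
    rw [Finset.sum_comm]
    refine Finset.sum_congr rfl fun i _ => Finset.sum_congr rfl fun j _ => ?_
    rw [mul_comm]
  simp_rw [h, hE.inv_metric, Finset.sum_smul]
  conv_rhs => rw [Finset.sum_comm]
  refine Finset.sum_congr rfl fun i _ => ?_
  rw [Finset.sum_comm]

theorem inner_eq_zero_of_mem_orthogonal_tangentPlane {v : EuclideanSpace ℝ (Fin N)}
    (hv : v ∈ (tangentPlane X y)ᗮ) (w : EuclideanSpace ℝ (Fin n)) :
    inner ℝ v (fderiv ℝ X y w) = 0 :=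
  (Submodule.mem_orthogonal' _ _).mp hv _ ⟨w, rfl⟩

/-- The normal projection in coordinates. -/
theorem starProjection_orthogonal_tangentPlane (hX : Function.Injective (fderiv ℝ X y))
    (v : EuclideanSpace ℝ (Fin N)) :
    (tangentPlane X y)ᗮ.starProjection v =
      v - ∑ k, (∑ l, (metric X y)⁻¹ k l * inner ℝ v (pderiv l X y)) • pderiv k X y := by
  set w := ∑ k, (∑ l, (metric X y)⁻¹ k l * inner ℝ v (pderiv l X y)) • pderiv k X y with hw
  have hwK : w ∈ tangentPlane X y :=
    Submodule.sum_mem _ fun k _ => Submodule.smul_mem _ _ ⟨_, rfl⟩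
  -- The coefficients of `w` solve the normal equations of the projection.
  have hl : ∀ m, inner ℝ (v - w) (pderiv m X y) = 0 := by
    intro m
    have h1 : (metric X y)⁻¹.transpose * metric X y = 1 := by
      obtain ⟨E, hE⟩ := exists_isFrame hX
      have : (metric X y)⁻¹.transpose = (metric X y)⁻¹ := by
        ext i j
        rw [Matrix.transpose_apply, hE.inv_metric, hE.inv_metric]
        simp_rw [mul_comm]
      rw [this]
      exact Matrix.nonsing_inv_mul _ (isUnit_det_metric hX)
    have h2 : inner ℝ w (pderiv m X y) =
        ∑ l, ((metric X y)⁻¹.transpose * metric X y) l m * inner ℝ v (pderiv l X y) := by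
      simp only [hw, sum_inner, inner_smul_left, Matrix.mul_apply, Matrix.transpose_apply,
        Finset.sum_mul, map_sum]
      rw [Finset.sum_comm]
      refine Finset.sum_congr rfl fun i _ => Finset.sum_congr rfl fun j _ => ?_
      simp [metric]
      ring
    rw [inner_sub_left, h2, h1]
    simp [Matrix.one_apply]
  have hN : v - w ∈ (tangentPlane X y)ᗮ := by
    rw [Submodule.mem_orthogonal']
    rintro _ ⟨u, rfl⟩
    rw [euclidean_eq_sum_single u]
    simp only [map_sum, map_smul, inner_sum, inner_smul_right]
    exact Finset.sum_eq_zero fun i _ => by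
      rw [show inner ℝ (v - w) ((fderiv ℝ X y).toLinearMap (EuclideanSpace.single i 1)) = 0
        from hl i, mul_zero]
  have h0 : (tangentPlane X y)ᗮ.starProjection w = 0 := by
    rw [Submodule.starProjection_apply_eq_zero_iff]
    exact Submodule.le_orthogonal_orthogonal _ hwK
  calc (tangentPlane X y)ᗮ.starProjection v
      = (tangentPlane X y)ᗮ.starProjection (v - w) + (tangentPlane X y)ᗮ.starProjection w := by
        rw [← map_add, sub_add_cancel]
    _ = v - w := by rw [h0, add_zero, Submodule.starProjection_eq_self_iff.mpr hN]

theorem pderiv_metric (hX : ContDiffAt ℝ 2 X y) (i j l : Fin n) :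
    pderiv i (fun z => metric X z j l) y =
      inner ℝ (pderiv i (pderiv j X) y) (pderiv l X y) +
        inner ℝ (pderiv j X y) (pderiv i (pderiv l X) y) := by
  have hd : ∀ m, DifferentiableAt ℝ (pderiv m X) y := fun m =>
    ((hX.fderiv_right (m := 1) (by norm_num)).clm_apply contDiffAt_const).differentiableAt
      (by norm_num)
  change fderiv ℝ (fun z => inner ℝ (pderiv j X z) (pderiv l X z)) y _ = _
  rw [fderiv_inner_apply ℝ (hd j) (hd l), add_comm]
  rfl

/-- By the product rule and the symmetry of second derivatives, four of the six terms cancel and the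
other two agree. The Christoffel symbols are thus the tangential coefficients of ∂ᵢ∂ⱼX, so the
Hessian of X is its second fundamental form. -/
theorem christoffel_eq (hX : ContDiffAt ℝ 2 X y) (k i j : Fin n) :
    christoffel X k i j y =
      ∑ l, (metric X y)⁻¹ k l * inner ℝ (pderiv i (pderiv j X) y) (pderiv l X y) := by
  have hs : ∀ a b, pderiv a (pderiv b X) y = pderiv b (pderiv a X) y := fun a b => by
    rw [pderiv_pderiv hX, pderiv_pderiv hX, fderiv_fderiv_symm hX]
  unfold christoffel
  rw [Finset.mul_sum]
  refine Finset.sum_congr rfl fun l _ => ?_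
  rw [pderiv_metric hX, pderiv_metric hX, pderiv_metric hX, hs j i, hs l i, hs l j,
    real_inner_comm (pderiv i (pderiv l X) y) (pderiv j X y)]
  ring

theorem secondFundamentalForm_eq (hX : ContDiffAt ℝ 2 X y)
    (hinj : Function.Injective (fderiv ℝ X y)) (i j : Fin n) :
    secondFundamentalForm X i j y =
      pderiv i (pderiv j X) y - ∑ k, christoffel X k i j y • pderiv k X y := by
  simp_rw [christoffel_eq hX]
  exact starProjection_orthogonal_tangentPlane hinj _

/-- The Beltrami formula `Δ X = n H`. -/
theorem localMeanCurvature_eq (hX : ContDiffAt ℝ 2 X y)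
    (hinj : Function.Injective (fderiv ℝ X y)) :
    localMeanCurvature X y = (1 / (n : ℝ)) • localLaplacian X X y := by
  simp_rw [localMeanCurvature, secondFundamentalForm_eq hX hinj]
  rfl

theorem IsFrame.localMeanCurvature_eq_sum (hE : IsFrame X y E) (hX : ContDiffAt ℝ 2 X y) :
    localMeanCurvature X y = (1 / (n : ℝ)) • (tangentPlane X y)ᗮ.starProjection
      (∑ k, fderiv ℝ (fderiv ℝ X) y (E k) (E k)) := by
  rw [← hE.sum_inv_metric_smul]
  simp_rw [localMeanCurvature, secondFundamentalForm, map_sum, map_smul, pderiv_pderiv hX]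

theorem localMeanCurvature_mem_orthogonal :
    localMeanCurvature X y ∈ (tangentPlane X y)ᗮ :=
  Submodule.smul_mem _ _ (Submodule.sum_mem _ fun _ _ => Submodule.sum_mem _ fun _ _ =>
    Submodule.smul_mem _ _ (Submodule.starProjection_apply_mem _ _))

/-- The first-order part of the Laplace operator in coordinates. -/
noncomputable def laplacianDrift (X : EuclideanSpace ℝ (Fin n) → EuclideanSpace ℝ (Fin N))
    (y : EuclideanSpace ℝ (Fin n)) : EuclideanSpace ℝ (Fin n) :=
  ∑ i, ∑ j, (metric X y)⁻¹ i j • ∑ k, christoffel X k i j y • EuclideanSpace.single k 1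

theorem IsFrame.localLaplacian_eq (hE : IsFrame X y E) {f : EuclideanSpace ℝ (Fin n) → F}
    (hf : ContDiffAt ℝ 2 f y) :
    localLaplacian X f y =
      ∑ k, fderiv ℝ (fderiv ℝ f) y (E k) (E k) - fderiv ℝ f y (laplacianDrift X y) := by
  rw [← hE.sum_inv_metric_smul]
  simp_rw [localLaplacian, laplacianDrift, smul_sub, Finset.sum_sub_distrib, map_sum, map_smul,
    map_sum, map_smul, pderiv_pderiv hf]
  rfl

end Frames

/-! ### Second derivatives of products, composites and at maxima -/

section Calculus

variable {E F G H : Type*} [NormedAddCommGroup E] [NormedSpace ℝ E]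
  [NormedAddCommGroup F] [NormedSpace ℝ F] [NormedAddCommGroup G] [NormedSpace ℝ G]
  [NormedAddCommGroup H] [NormedSpace ℝ H]

theorem hasFDerivAt_fderiv {f : E → F} {y : E} (hf : ContDiffAt ℝ 2 f y) :
    HasFDerivAt (fderiv ℝ f) (fderiv ℝ (fderiv ℝ f) y) y :=
  ((hf.fderiv_right (m := 1) (by norm_num)).differentiableAt (by norm_num)).hasFDerivAt

theorem eventually_differentiableAt {f : E → F} {y : E} (hf : ContDiffAt ℝ 2 f y) :
    ∀ᶠ z in nhds y, DifferentiableAt ℝ f z :=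
  (hf.eventually (by simp)).mono fun _ h => h.differentiableAt (by norm_num)

/-- The second derivative of a bilinear expression in two functions. -/
theorem fderiv_fderiv_bilinear (B : F →L[ℝ] G →L[ℝ] H) {f : E → F} {g : E → G} {y : E}
    (hf : ContDiffAt ℝ 2 f y) (hg : ContDiffAt ℝ 2 g y) (v w : E) :
    fderiv ℝ (fderiv ℝ fun z => B (f z) (g z)) y v w =
      B (fderiv ℝ (fderiv ℝ f) y v w) (g y) + B (fderiv ℝ f y v) (fderiv ℝ g y w) +
      B (fderiv ℝ f y w) (fderiv ℝ g y v) + B (f y) (fderiv ℝ (fderiv ℝ g) y v w) := by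
  have h1 : fderiv ℝ (fun z => B (f z) (g z)) =ᶠ[nhds y]
      fun z => B.precompR E (f z) (fderiv ℝ g z) + B.precompL E (fderiv ℝ f z) (g z) := by
    filter_upwards [eventually_differentiableAt hf, eventually_differentiableAt hg] with z hz hz'
    exact (B.hasFDerivAt_of_bilinear hz.hasFDerivAt hz'.hasFDerivAt).fderiv
  have hf1 := (hf.differentiableAt (by norm_num)).hasFDerivAt
  have hg1 := (hg.differentiableAt (by norm_num)).hasFDerivAt
  have h2 := ((B.precompR E).hasFDerivAt_of_bilinear hf1 (hasFDerivAt_fderiv hg)).add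
    ((B.precompL E).hasFDerivAt_of_bilinear (hasFDerivAt_fderiv hf) hg1)
  rw [h1.fderiv_eq]
  rw [show (fun z => B.precompR E (f z) (fderiv ℝ g z) + B.precompL E (fderiv ℝ f z) (g z)) =
    (fun z => B.precompR E (f z) (fderiv ℝ g z)) + fun z => B.precompL E (fderiv ℝ f z) (g z)
    from rfl, h2.fderiv]
  simp
  abel

theorem fderiv_fderiv_comp {f : F → G} {φ : E → F} {y : E}
    (hf : ContDiffAt ℝ 2 f (φ y)) (hφ : ContDiffAt ℝ 2 φ y) (v w : E) :
    fderiv ℝ (fderiv ℝ (f ∘ φ)) y v w =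
      fderiv ℝ (fderiv ℝ f) (φ y) (fderiv ℝ φ y v) (fderiv ℝ φ y w) +
        fderiv ℝ f (φ y) (fderiv ℝ (fderiv ℝ φ) y v w) := by
  have h1 : fderiv ℝ (f ∘ φ) =ᶠ[nhds y] fun z => (fderiv ℝ f (φ z)).comp (fderiv ℝ φ z) := by
    filter_upwards [eventually_differentiableAt hφ,
      hφ.continuousAt.eventually (eventually_differentiableAt hf)] with z hz hz'
    exact fderiv_comp z hz' hz
  have h2 := ((hasFDerivAt_fderiv hf).comp y
    (hφ.differentiableAt (by norm_num)).hasFDerivAt).clm_comp (hasFDerivAt_fderiv hφ)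
  rw [h1.fderiv_eq]
  rw [show (fun z => (fderiv ℝ f (φ z)).comp (fderiv ℝ φ z)) =
    fun z => ((fderiv ℝ f ∘ φ) z).comp (fderiv ℝ φ z) from rfl, h2.fderiv]
  simp [add_comm]

/-- Were the second derivative positive, the point would also be a local minimum, so `f` would be
locally constant and its second derivative zero. -/
theorem deriv_deriv_nonpos_of_isLocalMax {f : ℝ → ℝ} {t : ℝ} (h : IsLocalMax f t)
    (hc : ContinuousAt f t) : deriv (deriv f) t ≤ 0 := by
  by_contra! hpos
  have hmin := isLocalMin_of_deriv_deriv_pos hpos h.deriv_eq_zero hc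
  have hconst : f =ᶠ[nhds t] fun _ => f t := by
    filter_upwards [h, hmin] with z h1 h2 using le_antisymm h1 h2
  have h0 : deriv (deriv f) t = 0 := by
    rw [hconst.deriv.deriv_eq]
    simp
  exact hpos.ne' h0

theorem fderiv_fderiv_nonpos_of_isLocalMax {f : E → ℝ} {y : E} (h : IsLocalMax f y)
    (hf : ContDiffAt ℝ 2 f y) (v : E) : fderiv ℝ (fderiv ℝ f) y v v ≤ 0 := by
  let γ : ℝ → E := fun t => y + t • v
  have hγ : ∀ t, HasDerivAt γ v t := fun t => by
    have := ((hasDerivAt_id t).smul_const v).const_add y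
    rwa [one_smul] at this
  have hγ0 : γ 0 = y := by simp [γ]
  have ht : Filter.Tendsto γ (nhds 0) (nhds y) := hγ0 ▸ (hγ 0).continuousAt
  have hmax : IsLocalMax (f ∘ γ) 0 := by
    change ∀ᶠ t in nhds 0, f (γ t) ≤ f (γ 0)
    rw [hγ0]
    exact ht.eventually h
  have h1 : deriv (f ∘ γ) =ᶠ[nhds 0] fun t => fderiv ℝ f (γ t) v := by
    filter_upwards [ht.eventually (eventually_differentiableAt hf)] with t hd
    exact (hd.hasFDerivAt.comp_hasDerivAt t (hγ t)).deriv
  have h2 : HasDerivAt (fun t => fderiv ℝ f (γ t)) (fderiv ℝ (fderiv ℝ f) y v) 0 :=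
    HasFDerivAt.comp_hasDerivAt (x := (0 : ℝ)) (f := γ)
      (by rw [hγ0]; exact hasFDerivAt_fderiv hf) (hγ 0)
  have h3 : deriv (deriv (f ∘ γ)) 0 = fderiv ℝ (fderiv ℝ f) y v v := by
    rw [h1.deriv_eq, (h2.clm_apply (hasDerivAt_const 0 v)).deriv]
    simp
  rw [← h3]
  exact deriv_deriv_nonpos_of_isLocalMax hmax
    (ContinuousAt.comp (by rw [hγ0]; exact hf.continuousAt) (hγ 0).continuousAt)

theorem contDiffAt_det {ι : Type*} [Fintype ι] [DecidableEq ι] {A : E → Matrix ι ι ℝ} {y : E}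
    {m : WithTop ℕ∞} (hA : ∀ i j, ContDiffAt ℝ m (fun z => A z i j) y) :
    ContDiffAt ℝ m (fun z => (A z).det) y := by
  simp_rw [Matrix.det_apply]
  exact ContDiffAt.sum fun σ _ => (contDiffAt_prod fun i _ => hA _ _).const_smul _

/-- Cramer's rule: the entries are cofactors divided by a nonvanishing determinant. -/
theorem contDiffAt_inv_matrix {ι : Type*} [Fintype ι] [DecidableEq ι] {A : E → Matrix ι ι ℝ}
    {y : E} {m : WithTop ℕ∞} (hA : ∀ i j, ContDiffAt ℝ m (fun z => A z i j) y)
    (hdet : IsUnit (A y).det) (i j : ι) :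
    ContDiffAt ℝ m (fun z => (A z)⁻¹ i j) y := by
  simp_rw [Matrix.inv_def, Matrix.smul_apply, Ring.inverse_eq_inv', Matrix.adjugate_apply]
  refine ((contDiffAt_det hA).inv hdet.ne_zero).smul (contDiffAt_det fun a b => ?_)
  by_cases h : a = j
  · subst h; simpa using contDiffAt_const
  · simpa [Matrix.updateRow_ne h] using hA a b

end Calculus

/-! ### Invariance and smoothness of the mean curvature vector -/

section MeanCurvature

variable {n N : ℕ} {X : EuclideanSpace ℝ (Fin n) → EuclideanSpace ℝ (Fin N)}
  {y : EuclideanSpace ℝ (Fin n)}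

/-- The mean curvature vector does not depend on the parametrization. -/
theorem localMeanCurvature_comp {φ : EuclideanSpace ℝ (Fin n) → EuclideanSpace ℝ (Fin n)}
    (hX : ContDiffAt ℝ 2 X (φ y)) (hφ : ContDiffAt ℝ 2 φ y)
    (hinj : Function.Injective (fderiv ℝ (X ∘ φ) y)) :
    localMeanCurvature (X ∘ φ) y = localMeanCurvature X (φ y) := by
  have hd : fderiv ℝ (X ∘ φ) y = (fderiv ℝ X (φ y)).comp (fderiv ℝ φ y) :=
    fderiv_comp y (hX.differentiableAt (by norm_num)) (hφ.differentiableAt (by norm_num))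
  have hφinj : Function.Injective (fderiv ℝ φ y).toLinearMap := by
    rw [hd] at hinj
    exact Function.Injective.of_comp hinj
  have htan : tangentPlane (X ∘ φ) y = tangentPlane X (φ y) := by
    unfold tangentPlane
    rw [hd, ContinuousLinearMap.toLinearMap_comp]
    exact LinearMap.range_comp_of_range_eq_top _
      (LinearMap.range_eq_top.mpr (LinearMap.injective_iff_surjective.mp hφinj))
  obtain ⟨E, hE⟩ := exists_isFrame hinj
  -- The pushed-forward frame has the same images in the ambient space.
  have hE' : IsFrame X (φ y) fun k => fderiv ℝ φ y (E k) := by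
    unfold IsFrame at hE
    rwa [hd] at hE
  rw [hE.localMeanCurvature_eq_sum (hX.comp y hφ), hE'.localMeanCurvature_eq_sum hX, htan]
  simp_rw [fderiv_fderiv_comp hX hφ, Finset.sum_add_distrib, map_add]
  -- The extra term dX(D²φ(E, E)) of the chain rule is tangent, so the normal projection kills it.
  rw [add_eq_left.mpr]
  rw [← map_sum, Submodule.starProjection_apply_eq_zero_iff]
  exact Submodule.le_orthogonal_orthogonal _ ⟨_, rfl⟩

theorem contDiffAt_pderiv {F : Type*} [NormedAddCommGroup F] [NormedSpace ℝ F]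
    {f : EuclideanSpace ℝ (Fin n) → F} (hf : ContDiffAt ℝ ∞ f y) (i : Fin n) :
    ContDiffAt ℝ ∞ (pderiv i f) y :=
  (hf.fderiv_right (m := ∞) (by simp)).clm_apply contDiffAt_const

theorem eventually_injective_fderiv (hX : ContDiffAt ℝ ∞ X y)
    (hinj : Function.Injective (fderiv ℝ X y)) :
    ∀ᶠ z in nhds y, Function.Injective (fderiv ℝ X z) := by
  have hc : ContinuousAt (fderiv ℝ X) y := (hX.fderiv_right (m := ∞) (by simp)).continuousAt
  exact hc.eventually (ContinuousLinearMap.isOpen_injective.mem_nhds hinj)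

theorem contDiffAt_inv_metric (hX : ContDiffAt ℝ ∞ X y)
    (hinj : Function.Injective (fderiv ℝ X y)) (i j : Fin n) :
    ContDiffAt ℝ ∞ (fun z => (metric X z)⁻¹ i j) y :=
  contDiffAt_inv_matrix
    (fun _ _ => (contDiffAt_pderiv hX _).inner ℝ (contDiffAt_pderiv hX _))
    (isUnit_det_metric hinj) i j

/-- The coordinate formula for the normal projection exhibits H, near the point, as an algebraic
expression in the inverse metric and the derivatives of X. -/
theorem contDiffAt_localMeanCurvature (hX : ContDiffAt ℝ ∞ X y)
    (hinj : Function.Injective (fderiv ℝ X y)) :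
    ContDiffAt ℝ ∞ (localMeanCurvature X) y := by
  have h : localMeanCurvature X =ᶠ[nhds y] fun z => (1 / (n : ℝ)) • ∑ i, ∑ j,
      (metric X z)⁻¹ i j • (pderiv i (pderiv j X) z - ∑ k, (∑ l, (metric X z)⁻¹ k l *
        inner ℝ (pderiv i (pderiv j X) z) (pderiv l X z)) • pderiv k X z) := by
    filter_upwards [eventually_injective_fderiv hX hinj] with z hz
    simp_rw [← starProjection_orthogonal_tangentPlane hz]
    rfl
  refine ContDiffAt.congr_of_eventuallyEq ?_ h
  have hg := contDiffAt_inv_metric hX hinj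
  have h1 := fun i => contDiffAt_pderiv hX i
  have h2 := fun i j => contDiffAt_pderiv (h1 j) i
  refine ContDiffAt.const_smul _ (ContDiffAt.sum fun i _ => ContDiffAt.sum fun j _ =>
    (hg i j).smul ((h2 i j).sub (ContDiffAt.sum fun k _ => ContDiffAt.smul
      (ContDiffAt.sum fun l _ => (hg k l).mul ((h2 i j).inner ℝ (h1 l))) (h1 k))))

end MeanCurvature

/-! ### The maximum principle and the pointwise estimate -/

section MaximumPrinciple

variable {n N : ℕ} {X : EuclideanSpace ℝ (Fin n) → EuclideanSpace ℝ (Fin N)}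
  {y : EuclideanSpace ℝ (Fin n)} {E : Fin n → EuclideanSpace ℝ (Fin n)}

theorem IsFrame.localLaplacian_bilinear {F G H : Type*} [NormedAddCommGroup F] [NormedSpace ℝ F]
    [NormedAddCommGroup G] [NormedSpace ℝ G] [NormedAddCommGroup H] [NormedSpace ℝ H]
    (hE : IsFrame X y E) (B : F →L[ℝ] G →L[ℝ] H)
    {f : EuclideanSpace ℝ (Fin n) → F} {g : EuclideanSpace ℝ (Fin n) → G}
    (hf : ContDiffAt ℝ 2 f y) (hg : ContDiffAt ℝ 2 g y) :
    localLaplacian X (fun z => B (f z) (g z)) y =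
      B (localLaplacian X f y) (g y) + B (f y) (localLaplacian X g y) +
        (2 : ℝ) • ∑ k, B (fderiv ℝ f y (E k)) (fderiv ℝ g y (E k)) := by
  have hB : ContDiffAt ℝ 2 (fun z => B (f z) (g z)) y :=
    (B.contDiff.contDiffAt.comp y hf).clm_apply hg
  have h1 : fderiv ℝ (fun z => B (f z) (g z)) y (laplacianDrift X y) =
      B (f y) (fderiv ℝ g y (laplacianDrift X y)) + B (fderiv ℝ f y (laplacianDrift X y)) (g y) := by
    rw [(B.hasFDerivAt_of_bilinear (hf.differentiableAt (by norm_num)).hasFDerivAt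
      (hg.differentiableAt (by norm_num)).hasFDerivAt).fderiv]
    simp
  rw [hE.localLaplacian_eq hB, hE.localLaplacian_eq hf, hE.localLaplacian_eq hg, h1]
  simp_rw [fderiv_fderiv_bilinear B hf hg, Finset.sum_add_distrib, map_sub, map_sum,
    sub_apply, sum_apply, two_smul]
  abel

theorem IsFrame.localLaplacian_inner (hE : IsFrame X y E)
    {f g : EuclideanSpace ℝ (Fin n) → EuclideanSpace ℝ (Fin N)}
    (hf : ContDiffAt ℝ 2 f y) (hg : ContDiffAt ℝ 2 g y) :
    localLaplacian X (fun z => inner ℝ (f z) (g z)) y =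
      inner ℝ (localLaplacian X f y) (g y) + inner ℝ (f y) (localLaplacian X g y) +
        2 * ∑ k, inner ℝ (fderiv ℝ f y (E k)) (fderiv ℝ g y (E k)) := by
  obtain ⟨B, hB⟩ : ∃ B : EuclideanSpace ℝ (Fin N) →L[ℝ] EuclideanSpace ℝ (Fin N) →L[ℝ] ℝ,
      ∀ a b, B a b = inner ℝ a b := ⟨innerSL ℝ, fun _ _ => rfl⟩
  simpa only [hB, smul_eq_mul] using hE.localLaplacian_bilinear B hf hg

theorem IsFrame.localLaplacian_mul (hE : IsFrame X y E) {f g : EuclideanSpace ℝ (Fin n) → ℝ}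
    (hf : ContDiffAt ℝ 2 f y) (hg : ContDiffAt ℝ 2 g y) :
    localLaplacian X (fun z => f z * g z) y =
      localLaplacian X f y * g y + f y * localLaplacian X g y +
        2 * ∑ k, fderiv ℝ f y (E k) * fderiv ℝ g y (E k) :=
  hE.localLaplacian_bilinear (ContinuousLinearMap.mul ℝ ℝ) hf hg

theorem IsFrame.localLaplacian_const_sub (hE : IsFrame X y E) {f : EuclideanSpace ℝ (Fin n) → ℝ}
    (hf : ContDiffAt ℝ 2 f y) (c : ℝ) :
    localLaplacian X (fun z => c - f z) y = -localLaplacian X f y := by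
  have h : fderiv ℝ (fun z => c - f z) = fun z => -fderiv ℝ f z := by
    ext1 z; exact fderiv_const_sub c
  rw [hE.localLaplacian_eq (contDiffAt_const.sub hf), hE.localLaplacian_eq hf, h,
    fderiv_fun_neg]
  simp [Finset.sum_neg_distrib]
  ring

/-- The first-order part of Δ vanishes at a critical point, leaving a sum of nonpositive second
derivatives. -/
theorem IsFrame.localLaplacian_nonpos_of_isLocalMax (hE : IsFrame X y E)
    {f : EuclideanSpace ℝ (Fin n) → ℝ} (hf : ContDiffAt ℝ 2 f y) (hmax : IsLocalMax f y) :
    localLaplacian X f y ≤ 0 := by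
  rw [hE.localLaplacian_eq hf, hmax.fderiv_eq_zero]
  simpa using Finset.sum_nonpos fun k _ => fderiv_fderiv_nonpos_of_isLocalMax hmax hf (E k)

/-- At a maximum of `u² f` the Laplacians of `u` and `f` satisfy
`u² Δf + 2 u f Δu ≤ 6 f |∇u|²`. -/
theorem IsFrame.localLaplacian_le_of_isLocalMax_mul (hE : IsFrame X y E)
    {u f : EuclideanSpace ℝ (Fin n) → ℝ} (hu : ContDiffAt ℝ 2 u y) (hf : ContDiffAt ℝ 2 f y)
    (hpos : 0 < u y) (hmax : IsLocalMax (fun z => u z * u z * f z) y) :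
    u y ^ 2 * localLaplacian X f y + 2 * u y * f y * localLaplacian X u y ≤
      6 * f y * ∑ k, fderiv ℝ u y (E k) ^ 2 := by
  have hu1 := (hu.differentiableAt (by norm_num)).hasFDerivAt
  have hf1 := (hf.differentiableAt (by norm_num)).hasFDerivAt
  have hd1 : ∀ v, fderiv ℝ (fun z => u z * u z) y v = 2 * u y * fderiv ℝ u y v := fun v => by
    rw [(hu1.fun_mul hu1).fderiv]
    simp
    ring
  -- The critical point equation of u²f, divided by u > 0; it expresses ∇f through ∇u in the cross
  -- term below.
  have hd : ∀ v, u y * fderiv ℝ f y v = -2 * f y * fderiv ℝ u y v := fun v => by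
    have h0 := hmax.fderiv_eq_zero
    rw [((hu1.fun_mul hu1).fun_mul hf1).fderiv] at h0
    have h1 := DFunLike.congr_fun h0 v
    simp at h1
    apply mul_left_cancel₀ hpos.ne'
    linarith
  have h := hE.localLaplacian_nonpos_of_isLocalMax ((hu.mul hu).mul hf) hmax
  rw [hE.localLaplacian_mul (hu.mul hu) hf, hE.localLaplacian_mul hu hu] at h
  simp_rw [hd1] at h
  have hs : ∑ k, 2 * u y * fderiv ℝ u y (E k) * fderiv ℝ f y (E k) =
      -4 * f y * ∑ k, fderiv ℝ u y (E k) ^ 2 := by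
    rw [Finset.mul_sum]
    refine Finset.sum_congr rfl fun k _ => ?_
    linear_combination 2 * fderiv ℝ u y (E k) * hd (E k)
  rw [hs] at h
  simp_rw [← pow_two] at h
  linarith

variable {H : EuclideanSpace ℝ (Fin n) → EuclideanSpace ℝ (Fin N)}

/-- The derivative of the mean curvature vector is bounded below by its trace part:
`n |H|⁴ ≤ |DH|²`. -/
theorem IsFrame.mul_norm_meanCurvature_pow_le (hE : IsFrame X y E) (hX : ContDiffAt ℝ ∞ X y)
    (hinj : Function.Injective (fderiv ℝ X y)) (hH : H =ᶠ[nhds y] localMeanCurvature X)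
    (hn : 0 < n) :
    n * ‖H y‖ ^ 4 ≤ ∑ k, ‖fderiv ℝ H y (E k)‖ ^ 2 := by
  have hX2 : ContDiffAt ℝ 2 X y := hX.of_le ENat.LEInfty.out
  have hH1 : DifferentiableAt ℝ H y :=
    ((contDiffAt_localMeanCurvature hX hinj).congr_of_eventuallyEq hH).differentiableAt (by simp)
  have hnR : (0 : ℝ) < n := by exact_mod_cast hn
  -- Differentiate ⟨H, dX(v)⟩ = 0, which holds near the point because H is normal.
  have hweingarten : ∀ v, inner ℝ (fderiv ℝ H y v) (fderiv ℝ X y v) =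
      -inner ℝ (H y) (fderiv ℝ (fderiv ℝ X) y v v) := by
    intro v
    have h0 : (fun z => inner ℝ (H z) (fderiv ℝ X z v)) =ᶠ[nhds y] fun _ => (0 : ℝ) := by
      filter_upwards [hH] with z hz
      rw [hz]
      exact inner_eq_zero_of_mem_orthogonal_tangentPlane localMeanCurvature_mem_orthogonal v
    have h1 := (hasFDerivAt_fderiv hX2).clm_apply (hasFDerivAt_const v y)
    have h2 := DFunLike.congr_fun (h0.fderiv_eq (𝕜 := ℝ)) v
    rw [fderiv_inner_apply ℝ hH1 h1.differentiableAt, h1.fderiv] at h2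
    simp at h2
    linarith
  have hsum : ∑ k, inner ℝ (fderiv ℝ H y (E k)) (fderiv ℝ X y (E k)) = -(n * ‖H y‖ ^ 2) := by
    have hmem : H y ∈ (tangentPlane X y)ᗮ := by
      rw [hH.self_of_nhds]; exact localMeanCurvature_mem_orthogonal
    -- Beltrami: the trace of D²X is nH up to the tangent drift term, which is orthogonal to H.
    have hL : (∑ k, fderiv ℝ (fderiv ℝ X) y (E k) (E k)) =
        (n : ℝ) • H y + fderiv ℝ X y (laplacianDrift X y) := by
      rw [hH.self_of_nhds, localMeanCurvature_eq hX2 hinj, hE.localLaplacian_eq hX2, smul_smul,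
        mul_one_div_cancel hnR.ne', one_smul, sub_add_cancel]
    simp_rw [hweingarten, Finset.sum_neg_distrib, ← inner_sum, hL]
    rw [inner_add_right, inner_eq_zero_of_mem_orthogonal_tangentPlane hmem, inner_smul_right,
      real_inner_self_eq_norm_sq, add_zero]
  -- Cauchy–Schwarz twice: against the unit vectors dX(E k), then over the n summands.
  have h1 : n * ‖H y‖ ^ 2 ≤ ∑ k, ‖fderiv ℝ H y (E k)‖ := by
    rw [← neg_le_neg_iff, ← hsum, ← Finset.sum_neg_distrib]
    refine Finset.sum_le_sum fun k _ => ?_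
    have := (abs_le.mp (abs_real_inner_le_norm (fderiv ℝ H y (E k)) (fderiv ℝ X y (E k)))).1
    rwa [hE.1 k, mul_one] at this
  have h2 : (∑ k, ‖fderiv ℝ H y (E k)‖) ^ 2 ≤ n * ∑ k, ‖fderiv ℝ H y (E k)‖ ^ 2 := by
    simpa using sq_sum_le_card_mul_sum_sq (s := Finset.univ)
      (f := fun k => ‖fderiv ℝ H y (E k)‖)
  have h3 : (n * ‖H y‖ ^ 2) ^ 2 ≤ n * ∑ k, ‖fderiv ℝ H y (E k)‖ ^ 2 :=
    (pow_le_pow_left₀ (by positivity) h1 2).trans h2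
  refine le_of_mul_le_mul_left ?_ hnR
  calc (n : ℝ) * (n * ‖H y‖ ^ 4) = (n * ‖H y‖ ^ 2) ^ 2 := by ring
    _ ≤ _ := h3

/-- Dividing `hest` by 2h² and bounding u by R² gives, for t = uh, the inequality t² ≤ 2Rt + 14R².
Hence t ≤ (1 + √15)R, and 1 + √15 < 5. -/
theorem le_of_quadratic_estimate {m u h R S Q L : ℝ} (hm : 1 ≤ m) (hu : 0 < u) (huR : u ≤ R ^ 2)
    (hh : 0 ≤ h) (hR : 0 < R) (hS : m * h ^ 4 ≤ S) (hQ : Q ≤ 4 * R ^ 2)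
    (hL : -(2 * m * h * R + 2 * m) ≤ L)
    (hest : u ^ 2 * (2 * S) + 2 * u * h ^ 2 * L ≤ 6 * h ^ 2 * Q) : u * h ≤ 5 * R := by
  rcases hh.eq_or_lt with rfl | hh
  · simpa using hR.le
  have h1 : u ^ 2 * (2 * (m * h ^ 4)) ≤ u ^ 2 * (2 * S) := by gcongr
  have h2 : 2 * u * h ^ 2 * -(2 * m * h * R + 2 * m) ≤ 2 * u * h ^ 2 * L := by gcongr
  have h3 : 6 * h ^ 2 * Q ≤ 6 * h ^ 2 * (4 * R ^ 2) := by gcongr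
  have h4 : m * (u * h) ^ 2 ≤ 2 * m * (u * h) * R + 2 * m * u + 12 * R ^ 2 := by
    refine le_of_mul_le_mul_left ?_ (show 0 < 2 * h ^ 2 by positivity)
    linarith
  have h5 : 2 * m * u ≤ 2 * m * R ^ 2 := by gcongr
  have h6 : 12 * R ^ 2 ≤ m * (12 * R ^ 2) := le_mul_of_one_le_left (by positivity) hm
  have h7 : (u * h) ^ 2 ≤ 2 * (u * h) * R + 14 * R ^ 2 := by
    refine le_of_mul_le_mul_left ?_ (show 0 < m by linarith)
    linarith
  by_contra! hlt
  nlinarith [mul_pos hR hR]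

/-- An interior maximum of `(R² - |X|²)² |H|²`, with `H` the mean curvature vector and `Δ H = 0`,
is at most `25 R²`. -/
theorem mul_norm_le_of_isLocalMax (hn : 0 < n) (hX : ContDiffAt ℝ ∞ X y)
    (hinj : Function.Injective (fderiv ℝ X y)) (hH : H =ᶠ[nhds y] localMeanCurvature X)
    (hbih : localLaplacian X H y = 0) {R : ℝ} (hR : ‖X y‖ < R)
    (hmax : IsLocalMax (fun z => ((R ^ 2 - ‖X z‖ ^ 2) * ‖H z‖) ^ 2) y) :
    (R ^ 2 - ‖X y‖ ^ 2) * ‖H y‖ ≤ 5 * R := by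
  obtain ⟨E, hE⟩ := exists_isFrame hinj
  have hX2 : ContDiffAt ℝ 2 X y := hX.of_le ENat.LEInfty.out
  have hH2 : ContDiffAt ℝ 2 H y :=
    ((contDiffAt_localMeanCurvature hX hinj).congr_of_eventuallyEq hH).of_le
      ENat.LEInfty.out
  have hR0 : 0 < R := (norm_nonneg _).trans_lt hR
  have hnR : (1 : ℝ) ≤ n := by exact_mod_cast hn
  have hXX := hX2.inner ℝ hX2
  have hLX : localLaplacian X X y = (n : ℝ) • H y := by
    rw [hH.self_of_nhds, localMeanCurvature_eq hX2 hinj, smul_smul,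
      mul_one_div_cancel (by linarith), one_smul]
  let u := fun z => R ^ 2 - inner ℝ (X z) (X z)
  let f := fun z => inner ℝ (H z) (H z)
  have hu : ContDiffAt ℝ 2 u y := contDiffAt_const.sub hXX
  have huy : u y = R ^ 2 - ‖X y‖ ^ 2 := by simp [u]
  have hfy : f y = ‖H y‖ ^ 2 := by simp [f]
  have hpos : 0 < u y := by
    rw [huy]
    nlinarith [norm_nonneg (X y)]
  have hmax' : IsLocalMax (fun z => u z * u z * f z) y := by
    convert hmax using 2 with z
    simp only [u, f, real_inner_self_eq_norm_sq]
    ring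
  have hest := hE.localLaplacian_le_of_isLocalMax_mul hu (hH2.inner ℝ hH2) hpos hmax'
  -- Biharmonicity enters here: only the gradient term of Δ|H|² survives.
  have hLf : localLaplacian X f y = 2 * ∑ k, ‖fderiv ℝ H y (E k)‖ ^ 2 := by
    rw [hE.localLaplacian_inner hH2 hH2, hbih]
    simp
  have hLu : localLaplacian X u y = -(2 * n * inner ℝ (X y) (H y) + 2 * n) := by
    rw [hE.localLaplacian_const_sub hXX, hE.localLaplacian_inner hX2 hX2, hLX]
    simp only [real_inner_self_eq_norm_sq, hE.1]
    rw [real_inner_smul_left, real_inner_smul_right, real_inner_comm]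
    simp
    ring
  have hdu : ∀ v, fderiv ℝ u y v = -2 * inner ℝ (fderiv ℝ X y v) (X y) := fun v => by
    have hd := hX2.differentiableAt (by norm_num)
    rw [show fderiv ℝ u y = _ from fderiv_const_sub _, neg_apply, fderiv_inner_apply ℝ hd hd,
      real_inner_comm]
    ring
  have hQ : ∑ k, fderiv ℝ u y (E k) ^ 2 ≤ 4 * R ^ 2 := by
    -- Bessel's inequality for X against the orthonormal vectors dX(E k).
    have hb := Orthonormal.sum_inner_products_le (X y) hE (s := Finset.univ)
    simp_rw [hdu, mul_pow, ← Finset.mul_sum]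
    simp_rw [Real.norm_eq_abs, sq_abs] at hb
    nlinarith [norm_nonneg (X y)]
  rw [← huy]
  rw [hLf, show inner ℝ (H y) (H y) = _ from hfy] at hest
  refine le_of_quadratic_estimate hnR hpos ?_ (norm_nonneg _) hR0
    (hE.mul_norm_meanCurvature_pow_le hX hinj hH hn) hQ ?_ hest
  · rw [huy]; nlinarith [norm_nonneg (X y)]
  · rw [hLu]
    have h1 : inner ℝ (X y) (H y) ≤ ‖H y‖ * R :=
      (real_inner_le_norm _ _).trans (by rw [mul_comm]; gcongr)
    have h2 : 2 * (n : ℝ) * inner ℝ (X y) (H y) ≤ 2 * n * (‖H y‖ * R) := by gcongr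
    linarith

end MaximumPrinciple

/-! ### Passage to the manifold through charts -/

section Charts

variable {n N : ℕ}

theorem localMeanCurvature_congr {X X' : EuclideanSpace ℝ (Fin n) → EuclideanSpace ℝ (Fin N)}
    {y : EuclideanSpace ℝ (Fin n)} (h : X =ᶠ[nhds y] X') :
    localMeanCurvature X y = localMeanCurvature X' y := by
  have h1 : ∀ j, pderiv j X =ᶠ[nhds y] pderiv j X' := fun j => by
    filter_upwards [h.fderiv (𝕜 := ℝ)] with z hz
    rw [pderiv, pderiv, hz]
  have h2 : ∀ i j, pderiv i (pderiv j X) y = pderiv i (pderiv j X') y := fun i j => by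
    rw [pderiv, pderiv, (h1 j).fderiv_eq]
  have h3 : metric X y = metric X' y := by
    ext i j
    simp only [metric, Matrix.of_apply, (h1 _).eq_of_nhds]
  simp_rw [localMeanCurvature, secondFundamentalForm, tangentPlane, h2, h3, h.fderiv_eq]

variable {M : Type*} [TopologicalSpace M] [ChartedSpace (EuclideanSpace ℝ (Fin n)) M]
  [IsManifold (𝓡 n) ∞ M] {x : M → EuclideanSpace ℝ (Fin N)}

theorem IsSmoothImmersion.contDiffAt_comp_symm (hx : IsSmoothImmersion (n := n) x) (p : M)
    {z : EuclideanSpace ℝ (Fin n)} (hz : z ∈ (chartAt (EuclideanSpace ℝ (Fin n)) p).target) :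
    ContDiffAt ℝ ∞ (x ∘ (chartAt (EuclideanSpace ℝ (Fin n)) p).symm) z := by
  have h := (contMDiffOn_chart_symm (I := 𝓡 n) (n := ∞) (x := p)).contMDiffAt
    ((chartAt (EuclideanSpace ℝ (Fin n)) p).open_target.mem_nhds hz)
  exact contMDiffAt_iff_contDiffAt.mp (hx.smooth.contMDiffAt.comp z h)

theorem IsSmoothImmersion.injective_fderiv_comp_symm (hx : IsSmoothImmersion (n := n) x) (p : M)
    {z : EuclideanSpace ℝ (Fin n)} (hz : z ∈ (chartAt (EuclideanSpace ℝ (Fin n)) p).target) :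
    Function.Injective (fderiv ℝ (x ∘ (chartAt (EuclideanSpace ℝ (Fin n)) p).symm) z) := by
  have : IsManifold (𝓡 n) 1 M := IsManifold.of_le (n := ∞) ENat.LEInfty.out
  have hc := mdifferentiable_chart (I := 𝓡 n) (H := EuclideanSpace ℝ (Fin n)) p
  rw [← mfderiv_eq_fderiv, mfderiv_comp z (hx.smooth.mdifferentiableAt (by simp))
    (hc.symm.mdifferentiableAt hz)]
  exact (hx.injective_mfderiv _).comp (hc.symm.mfderiv_injective hz)

/-- The mean curvature vector can be computed in any chart of the atlas around the point. -/
theorem IsSmoothImmersion.meanCurvature_eq (hx : IsSmoothImmersion (n := n) x) (p : M) {q : M}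
    (hq : q ∈ (chartAt (EuclideanSpace ℝ (Fin n)) p).source) :
    meanCurvature (n := n) x q =
      localMeanCurvature (x ∘ (chartAt (EuclideanSpace ℝ (Fin n)) p).symm)
        (chartAt (EuclideanSpace ℝ (Fin n)) p q) := by
  set c := chartAt (EuclideanSpace ℝ (Fin n)) p with hc
  set d := chartAt (EuclideanSpace ℝ (Fin n)) q with hd
  have hqd : q ∈ d.source := mem_chart_source _ q
  have hdq : d.symm (d q) = q := d.left_inv hqd
  have hsymm : ContMDiffAt (𝓡 n) (𝓡 n) ∞ d.symm (d q) :=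
    contMDiffOn_chart_symm.contMDiffAt (d.open_target.mem_nhds (d.map_source hqd))
  have hchart : ContMDiffAt (𝓡 n) (𝓡 n) ∞ c (d.symm (d q)) := by
    rw [hdq]
    exact contMDiffOn_chart.contMDiffAt (c.open_source.mem_nhds hq)
  have hφ : ContDiffAt ℝ ∞ (c ∘ d.symm) (d q) :=
    contMDiffAt_iff_contDiffAt.mp (hchart.comp (d q) hsymm)
  have hφq : (c ∘ d.symm) (d q) = c q := congrArg c hdq
  have hX : ContDiffAt ℝ ∞ (x ∘ c.symm) ((c ∘ d.symm) (d q)) := by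
    rw [hφq]
    exact hx.contDiffAt_comp_symm p (c.map_source hq)
  -- The two chart expressions of `x` differ by the transition map, but only near `d q`, where the
  -- chart domains overlap.
  have heq : x ∘ d.symm =ᶠ[nhds (d q)] (x ∘ c.symm) ∘ (c ∘ d.symm) := by
    have ht : Filter.Tendsto d.symm (nhds (d q)) (nhds q) := by
      simpa only [hdq] using hsymm.continuousAt.tendsto
    filter_upwards [ht (c.open_source.mem_nhds hq)] with z hz
    simp only [Function.comp_apply, c.left_inv hz]
  change localMeanCurvature (x ∘ d.symm) (d q) = _
  rw [localMeanCurvature_congr heq, localMeanCurvature_comp (hX.of_le ENat.LEInfty.out)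
    (hφ.of_le ENat.LEInfty.out), hφq]
  rw [← heq.fderiv_eq]
  exact hx.injective_fderiv_comp_symm q (d.map_source hqd)

theorem IsSmoothImmersion.meanCurvature_comp_symm (hx : IsSmoothImmersion (n := n) x) (p : M) :
    meanCurvature (n := n) x ∘ (chartAt (EuclideanSpace ℝ (Fin n)) p).symm
      =ᶠ[nhds (chartAt (EuclideanSpace ℝ (Fin n)) p p)]
        localMeanCurvature (x ∘ (chartAt (EuclideanSpace ℝ (Fin n)) p).symm) := by
  set c := chartAt (EuclideanSpace ℝ (Fin n)) p with hc
  filter_upwards [c.open_target.mem_nhds (c.map_source (mem_chart_source _ p))] with z hz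
  rw [Function.comp_apply, hx.meanCurvature_eq p (c.map_target hz), ← hc, c.right_inv hz]

theorem IsSmoothImmersion.continuous_meanCurvature (hx : IsSmoothImmersion (n := n) x) :
    Continuous (meanCurvature (n := n) x) := by
  rw [continuous_iff_continuousAt]
  intro p
  set c := chartAt (EuclideanSpace ℝ (Fin n)) p with hc
  have hp : p ∈ c.source := mem_chart_source _ p
  have h1 : ContinuousAt (localMeanCurvature (x ∘ c.symm)) (c p) :=
    (contDiffAt_localMeanCurvature (hx.contDiffAt_comp_symm p (c.map_source hp))
      (hx.injective_fderiv_comp_symm p (c.map_source hp))).continuousAt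
  refine (h1.comp (c.continuousAt hp)).congr ?_
  filter_upwards [c.open_source.mem_nhds hp] with q hq
  exact (hx.meanCurvature_eq p hq).symm

/-- Interior estimate for the mean curvature of a properly immersed biharmonic submanifold. -/
theorem IsSmoothImmersion.mul_norm_meanCurvature_le (hn : 0 < n)
    (hx : IsSmoothImmersion (n := n) x)
    (hproper : ∀ K : Set (EuclideanSpace ℝ (Fin N)), IsCompact K → IsCompact (x ⁻¹' K))
    (hbih : IsBiharmonic (n := n) x) {q : M} {R : ℝ} (hR : ‖x q‖ < R) :
    (R ^ 2 - ‖x q‖ ^ 2) * ‖meanCurvature (n := n) x q‖ ≤ 5 * R := by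
  have hR0 : 0 < R := (norm_nonneg _).trans_lt hR
  have hmem : ∀ p, ‖x p‖ ≤ R → p ∈ x ⁻¹' Metric.closedBall 0 R := fun p h => by simpa using h
  have hxc : Continuous x := hx.smooth.continuous
  let Φ : M → ℝ := fun p => ((R ^ 2 - ‖x p‖ ^ 2) * ‖meanCurvature (n := n) x p‖) ^ 2
  have hΦ : Continuous Φ :=
    ((continuous_const.sub (hxc.norm.pow 2)).mul hx.continuous_meanCurvature.norm).pow 2
  obtain ⟨p, hpK, hpmax⟩ := (hproper _ (isCompact_closedBall 0 R)).exists_isMaxOn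
    ⟨q, hmem q hR.le⟩ hΦ.continuousOn
  have hqp : Φ q ≤ Φ p := hpmax (hmem q hR.le)
  have hpR : ‖x p‖ ≤ R := by simpa using hpK
  suffices h : Φ p ≤ (5 * R) ^ 2 from
    (abs_le_of_sq_le_sq' (hqp.trans h) (by positivity)).2
  -- On the boundary sphere the weight R² - |x|² is zero, so the maximum is trivial there.
  rcases hpR.eq_or_lt with hpR | hpR
  · simp only [Φ, hpR, sub_self, zero_mul, zero_pow two_ne_zero]
    positivity
  set c := chartAt (EuclideanSpace ℝ (Fin n)) p with hc
  have hps : p ∈ c.source := mem_chart_source _ p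
  have hcp : c.symm (c p) = p := c.left_inv hps
  -- Points near `p` stay in the open R-ball, so the maximum over the compact set is a local maximum
  -- on M.
  have hmaxM : ∀ᶠ r in nhds p, Φ r ≤ Φ p := by
    filter_upwards [hxc.norm.continuousAt.eventually (Iio_mem_nhds hpR)] with r hr
    exact hpmax (hmem r (le_of_lt hr))
  have hmax : IsLocalMax (fun z => ((R ^ 2 - ‖(x ∘ c.symm) z‖ ^ 2) *
      ‖(meanCurvature (n := n) x ∘ c.symm) z‖) ^ 2) (c p) := by
    change ∀ᶠ z in nhds (c p), Φ (c.symm z) ≤ Φ (c.symm (c p))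
    have ht : Filter.Tendsto c.symm (nhds (c p)) (nhds p) := by
      simpa only [hcp] using (c.symm.continuousAt (c.map_source hps)).tendsto
    rw [hcp]
    exact ht.eventually hmaxM
  have h := mul_norm_le_of_isLocalMax hn (hx.contDiffAt_comp_symm p (c.map_source hps))
    (hx.injective_fderiv_comp_symm p (c.map_source hps)) (hx.meanCurvature_comp_symm p)
    (hbih p) (R := R) (by simpa only [Function.comp_apply, ← hc, hcp] using hpR) hmax
  simp only [Function.comp_apply, ← hc, hcp] at h
  have hnonneg : 0 ≤ (R ^ 2 - ‖x p‖ ^ 2) * ‖meanCurvature (n := n) x p‖ :=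
    mul_nonneg (by nlinarith [norm_nonneg (x p)]) (norm_nonneg _)
  exact pow_le_pow_left₀ hnonneg h 2

end Charts

/-! ### Letting the radius grow -/

theorem eq_zero_of_forall_mul_le {r h : ℝ} (hr : 0 ≤ r) (hh : 0 ≤ h)
    (H : ∀ R, r < R → (R ^ 2 - r ^ 2) * h ≤ 5 * R) : h = 0 := by
  by_contra hne
  have hpos : 0 < h := lt_of_le_of_ne hh (Ne.symm hne)
  have hR : 0 < 2 * r + 10 / h := by positivity
  -- With this radius R > r, r² ≤ rR reduces the hypothesis to (R - r)h ≤ 5, while (R - r)h = rh +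
  -- 10.
  have h1 := H (2 * r + 10 / h) (by linarith [div_pos (show (0 : ℝ) < 10 by norm_num) hpos])
  have h2 : (2 * r + 10 / h) * h = 2 * r * h + 10 := by field_simp
  have h3 : r * r ≤ r * (2 * r + 10 / h) := by
    gcongr
    linarith [div_pos (show (0 : ℝ) < 10 by norm_num) hpos]
  generalize 2 * r + 10 / h = R at *
  have h4 : R * (R * h - r * h) ≤ R * 5 := by nlinarith
  have h5 := le_of_mul_le_mul_left h4 hR
  nlinarith [mul_nonneg hr hh]

end Submanifold

theorem theorem1 {n N : ℕ} {M : Type*} [TopologicalSpace M] [T2Space M]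
    [SecondCountableTopology M] [ChartedSpace (EuclideanSpace ℝ (Fin n)) M]
    [IsManifold (𝓡 n) ∞ M]
    (x : M → EuclideanSpace ℝ (Fin N))
    (himm : Submanifold.IsSmoothImmersion (n := n) x)
    (hproper : ∀ K : Set (EuclideanSpace ℝ (Fin N)), IsCompact K → IsCompact (x ⁻¹' K))
    (hbih : Submanifold.IsBiharmonic (n := n) x) :
    Submanifold.IsMinimal (n := n) x := by
  intro q
  -- The estimate needs n ≥ 1; for n = 0 the sum defining H is empty.
  rcases Nat.eq_zero_or_pos n with rfl | hn
  · simp [Submanifold.meanCurvature, Submanifold.localMeanCurvature]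
  · exact norm_eq_zero.mp (Submanifold.eq_zero_of_forall_mul_le (norm_nonneg (x q))
      (norm_nonneg _) fun R hR => himm.mul_norm_meanCurvature_le hn hproper hbih hR)
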